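/- Let $p\in\mathbb N$ and let $\mu$ be a Borel probability measure on $\mathbb R^p$ all of whose moments are finite. For $d\in\mathbb N$ let $\mathbb R_d[X]$ be the space of real polynomials in $X=(X_1,\dots,X_p)$ of degree at most $d$, let $v_d(X)=(X^\alpha)_{|\alpha|\le d}$ be the vector of monomials of degree at most $d$, and let $M_{\mu,d}=\int v_d(x)v_d(x)^T\,d\mu(x)$ (element-wise integral) be the moment matrix. A vector $c=(c_\alpha)_{|\alpha|\le d}$ is identified with the polynomial $\langle c,v_d(X)\rangle=\sum_{|\alpha|\le d} c_\alpha X^\alpha$. Let $V$ be the Zariski closure of $\operatorname{supp}(\mu)$, that is, the smallest real algebraic subset of $\mathbb R^p$ containing $\operatorname{supp}(\mu)$, and let $\mathcal I\subseteq\mathbb R[X]$ be the ideal of all polynomials vanishing on $V$. Let $\mathrm{HF}(d)=\dim_{\mathbb R}\mathbb R_d[X]/(\mathcal I\cap\mathbb R_d[X])$ be the Hilbert function of $V$, and let $\dim V$ be the Krull dimension of $\mathbb R[X]/\mathcal I$. Then: 1. $\mathcal I=\{P\in\mathbb R[X] : \int P^2\,d\mu=0\}$. 2. For every $d\in\mathbb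 N$, $\operatorname{rank}M_{\mu,d}=\mathrm{HF}(d)$, and this number is the dimension of the space of functions on $V$ that are restrictions of polynomials of degree at most $d$. 3. There is a polynomial $H\in\mathbb Q[t]$ of degree $\dim V$ such that $\operatorname{rank}M_{\mu,d}=H(d)$ for all sufficiently large $d$. 4. For all sufficiently large $d$, the polynomials $\langle c,v_d(X)\rangle$ with $c\in\ker M_{\mu,d}$ generate the ideal $\mathcal I$; moreover, the polynomials corresponding to any vector-space basis of $\ker M_{\mu,d}$ already generate $\mathcal I$. -/

import Mathlib

namespace MomentRank

/-- Exponents `α ∈ ℕ^p` with `|α| ≤ d`, i.e. the monomials of degree at most `d`. -/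
abbrev Exponent (p d : ℕ) : Type := {α : Fin p →₀ ℕ // α.degree ≤ d}

noncomputable instance (p d : ℕ) : Fintype (Exponent p d) :=
  (Finsupp.finite_of_degree_le d).fintype

/-- The value `x^α` of a monomial at a point of `ℝ^p`. -/
def monomialValue {p : ℕ} (α : Fin p →₀ ℕ) (x : Fin p → ℝ) : ℝ := ∏ i, x i ^ α i

/-- All moments of `μ` are finite. -/
def HasFiniteMoments {p : ℕ} (μ : MeasureTheory.Measure (Fin p → ℝ)) : Prop :=
  ∀ α : Fin p →₀ ℕ, MeasureTheory.Integrable (monomialValue α) μ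

/-- The moment matrix `∫ v_d(x) v_d(x)ᵀ dμ(x)`, where `v_d` is the vector of monomials of degree
at most `d` and the integral is taken element-wise. -/
noncomputable def momentMatrix {p : ℕ} (μ : MeasureTheory.Measure (Fin p → ℝ)) (d : ℕ) :
    Matrix (Exponent p d) (Exponent p d) ℝ :=
  Matrix.of fun α β => ∫ x, monomialValue α.1 x * monomialValue β.1 x ∂μ

/-- The polynomial `⟨c, v_d(X)⟩` of degree at most `d` with coefficient vector `c`. -/
noncomputable def polyOfCoeffs {p d : ℕ} (c : Exponent p d → ℝ) : MvPolynomial (Fin p) ℝ :=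
  ∑ α, MvPolynomial.monomial α.1 (c α)

/-- The kernel of the moment matrix, a space of coefficient vectors. -/
noncomputable def momentKernel {p : ℕ} (μ : MeasureTheory.Measure (Fin p → ℝ)) (d : ℕ) :
    Submodule ℝ (Exponent p d → ℝ) :=
  LinearMap.ker (momentMatrix μ d).mulVecLin

/-- Real algebraic subsets of `ℝ^p`: common zero sets of families of real polynomials. -/
def IsAlgebraicSet {p : ℕ} (W : Set (Fin p → ℝ)) : Prop :=
  ∃ F : Set (MvPolynomial (Fin p) ℝ), W = {x | ∀ P ∈ F, MvPolynomial.eval x P = 0}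

/-- The Zariski closure: the smallest real algebraic set containing `S`. -/
def zariskiClosure {p : ℕ} (S : Set (Fin p → ℝ)) : Set (Fin p → ℝ) :=
  ⋂₀ {W | IsAlgebraicSet W ∧ S ⊆ W}

/-- The (affine) Hilbert function of an ideal `I`: `d ↦ dim ℝ_d[X] / (I ∩ ℝ_d[X])`. -/
noncomputable def hilbertFunction {p : ℕ} (I : Ideal (MvPolynomial (Fin p) ℝ)) (d : ℕ) : ℕ :=
  Module.finrank ℝ
    (MvPolynomial.restrictTotalDegree (Fin p) ℝ d ⧸
      (I.restrictScalars ℝ).comap (MvPolynomial.restrictTotalDegree (Fin p) ℝ d).subtype)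

/-- Restriction of a polynomial to a function on the set `V`. -/
noncomputable def restrictTo {p : ℕ} (V : Set (Fin p → ℝ)) :
    MvPolynomial (Fin p) ℝ →ₗ[ℝ] (V → ℝ) where
  toFun P x := MvPolynomial.eval x.1 P
  map_add' P Q := by ext x; simp
  map_smul' c P := by ext x; simp

/-- The space of functions on `V` that are given by polynomials of degree at most `d`. -/
noncomputable def polynomialFunctions {p : ℕ} (V : Set (Fin p → ℝ)) (d : ℕ) :
    Submodule ℝ (V → ℝ) :=
  (MvPolynomial.restrictTotalDegree (Fin p) ℝ d).map (restrictTo V)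

/-- The dimension of a real algebraic set `V`: the Krull dimension of its ring of polynomial
functions `ℝ[X] / I(V)`. -/
noncomputable def algebraicDim {p : ℕ} (V : Set (Fin p → ℝ)) : WithBot ℕ∞ :=
  ringKrullDim (MvPolynomial (Fin p) ℝ ⧸ MvPolynomial.vanishingIdeal ℝ V)

end MomentRank

/-!
The quadratic form of the moment matrix is `c ↦ ∫ ⟨c, v_d⟩² dμ`. A polynomial whose square has
integral zero vanishes almost everywhere, hence, by continuity, on the support of `μ`, hence on its
Zariski closure `V`. This describes the vanishing ideal `I`, and it shows that the kernel of the
moment matrix consists of the coefficient vectors of the elements of `I` of degree at most `d`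
(`HasFiniteMoments.mem_momentKernel_iff`). Rank-nullity turns the latter into the equality of the
rank with the Hilbert function of `I`, and since `I` is finitely generated it is generated by its
elements of bounded degree.

What remains is that the affine Hilbert function of a proper ideal `I` of `k[X]` is eventually a
polynomial whose degree is the Krull dimension of `k[X] / I`
(`exists_hilbertPolynomial_natDegree_eq`).

* Division with respect to the degree lexicographic order shows that the standard monomials, those
  not divisible by a leading monomial of `I`, form a basis of `k[X] / I` compatible with degrees
  (`finrank_degreeFiltration`). By Dickson's lemma counting them amounts to counting the
  monomials outside finitely many translated orthants, and this count is eventually polynomial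
  (`exists_poly_ncard_degree_le_of_forall_not_le`).
* By Noether normalization `k[X] / I` is finite over a polynomial ring in `s` variables, and
  `s` is its Krull dimension because integral extensions preserve dimension. The embedding of
  the polynomial ring bounds the Hilbert function from below by a polynomial of degree `s` along an
  arithmetic progression, and finiteness bounds it from above by a polynomial of degree `s`;
  so the Hilbert polynomial has degree `s`.
-/

open Filter

/-! ### Krull dimension along integral extensions -/

/-- Lying over, going up and incomparability give the two inequalities. -/
theorem Algebra.IsIntegral.ringKrullDim_eq (R S : Type*) [CommRing R] [CommRing S] [Algebra R S]
    [Algebra.IsIntegral R S] (hinj : Function.Injective (algebraMap R S)) :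
    ringKrullDim S = ringKrullDim R := by
  apply le_antisymm
  · refine Order.krullDim_le_of_strictMono (PrimeSpectrum.comap (algebraMap R S)) fun P Q h => ?_
    exact Ideal.IsIntegral.comap_lt_comap (R := R) (I := P.asIdeal) (J := Q.asIdeal) h
  · refine iSup_le fun l => ?_
    obtain ⟨P, -, hP, hPl⟩ := Ideal.exists_ideal_over_prime_of_isIntegral (S := S)
      (RelSeries.head l).asIdeal ⊥ (by
        change RingHom.ker (algebraMap R S) ≤ _
        rw [(RingHom.injective_iff_ker_eq_bot _).1 hinj]
        exact bot_le)
    have : P.LiesOver (RelSeries.head l).asIdeal := ⟨hPl.symm⟩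
    obtain ⟨L, hL, -, -⟩ := Ideal.exists_ltSeries_of_hasGoingUp l P
    rw [← hL]
    exact Order.LTSeries.length_le_krullDim L

/-! ### Counting monomials -/

namespace MomentRank

/-- Splitting off the exponents of degree exactly `d` gives Pascal's recursion. -/
theorem ncard_degree_le (s d : ℕ) :
    {α : Fin s →₀ ℕ | α.degree ≤ d}.ncard = (d + s).choose d := by
  have heq (n : ℕ) : {α : Fin s →₀ ℕ | α.degree = n} =
      ((Finset.univ : Finset (Fin s)).finsuppAntidiag n : Set (Fin s →₀ ℕ)) := by
    ext α
    simp [Finset.mem_finsuppAntidiag, Finsupp.degree_eq_sum]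
  have hcard (n : ℕ) : {α : Fin s →₀ ℕ | α.degree = n}.ncard = (s + n - 1).choose n := by
    rw [heq, Set.ncard_coe_finset, Finset.card_finsuppAntidiag_nat_eq_choose, Finset.card_fin]
  induction d with
  | zero => simpa using hcard 0
  | succ d ih =>
    have hu : {α : Fin s →₀ ℕ | α.degree ≤ d + 1} =
        {α | α.degree ≤ d} ∪ {α | α.degree = d + 1} := by
      ext α
      simp only [Set.mem_ofPred_eq, Set.mem_union]
      omega
    rw [hu, Set.ncard_union_eq _ (Finsupp.finite_of_degree_le d) _, ih, hcard,
      show d + 1 + s = d + s + 1 by ring, Nat.choose_succ_succ,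
      show s + (d + 1) - 1 = d + s by omega]
    · rw [Set.disjoint_left]
      intro α h1 h2
      simp only [Set.mem_ofPred_eq] at h1 h2
      omega
    · rw [heq]
      exact Finset.finite_toSet _

theorem eval_preHilbertPoly_zero (s d : ℕ) :
    (Polynomial.preHilbertPoly ℚ s 0).eval (d : ℚ) = ((d + s).choose d : ℕ) := by
  rw [Polynomial.preHilbertPoly_eq_choose_sub_add ℚ s (Nat.zero_le d), Nat.sub_zero,
    Nat.choose_symm_add]

/-- Translation by `a` reduces the count to degree at most `d - a.degree`. -/
theorem ncard_ge_degree_le {s d : ℕ} (a : Fin s →₀ ℕ) (h : a.degree ≤ d) :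
    ({α : Fin s →₀ ℕ | a ≤ α ∧ α.degree ≤ d}.ncard : ℚ) =
      (Polynomial.preHilbertPoly ℚ s a.degree).eval (d : ℚ) := by
  have hset : {α : Fin s →₀ ℕ | a ≤ α ∧ α.degree ≤ d} =
      (fun β => a + β) '' {β | β.degree ≤ d - a.degree} := by
    ext α
    constructor
    · rintro ⟨h1, h2⟩
      obtain ⟨β, rfl⟩ := exists_add_of_le h1
      refine ⟨β, ?_, rfl⟩
      rw [map_add] at h2
      simp only [Set.mem_ofPred_eq]
      omega
    · rintro ⟨β, h1, rfl⟩
      simp only [Set.mem_ofPred_eq] at h1 ⊢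
      refine ⟨le_self_add, ?_⟩
      rw [map_add]
      omega
  rw [hset, Set.ncard_image_of_injective _ (add_right_injective a), ncard_degree_le,
    Polynomial.preHilbertPoly_eq_choose_sub_add ℚ s h, Nat.choose_symm_add]

/-- The induction is on `T`: passing from `T` to `T ∪ {t}` removes the monomials above `a ⊔ t`. -/
theorem exists_poly_ncard_ge_of_finset {s : ℕ} (T : Finset (Fin s →₀ ℕ)) (a : Fin s →₀ ℕ) :
    ∃ H : Polynomial ℚ, ∀ᶠ d : ℕ in atTop,
      ({α : Fin s →₀ ℕ | (a ≤ α ∧ α.degree ≤ d) ∧ ∀ t ∈ T, ¬ t ≤ α}.ncard : ℚ) =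
        H.eval (d : ℚ) := by
  classical
  induction T using Finset.induction_on generalizing a with
  | empty =>
    refine ⟨Polynomial.preHilbertPoly ℚ s a.degree, ?_⟩
    filter_upwards [eventually_ge_atTop a.degree] with d hd
    simpa using ncard_ge_degree_le a hd
  | insert t T _ ih =>
    obtain ⟨H₁, h₁⟩ := ih a
    obtain ⟨H₂, h₂⟩ := ih (a ⊔ t)
    refine ⟨H₁ - H₂, ?_⟩
    filter_upwards [h₁, h₂] with d h₁ h₂
    have hset : {α : Fin s →₀ ℕ | (a ≤ α ∧ α.degree ≤ d) ∧ ∀ u ∈ insert t T, ¬ u ≤ α} =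
        {α | (a ≤ α ∧ α.degree ≤ d) ∧ ∀ u ∈ T, ¬ u ≤ α} \
          {α | (a ⊔ t ≤ α ∧ α.degree ≤ d) ∧ ∀ u ∈ T, ¬ u ≤ α} := by
      ext α
      simp only [Finset.forall_mem_insert, Set.mem_ofPred_eq, Set.mem_sdiff, sup_le_iff]
      tauto
    have hfin (b : Fin s →₀ ℕ) :
        {α : Fin s →₀ ℕ | (b ≤ α ∧ α.degree ≤ d) ∧ ∀ u ∈ T, ¬ u ≤ α}.Finite :=
      (Finsupp.finite_of_degree_le d).subset fun α h => h.1.2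
    have hsub : {α : Fin s →₀ ℕ | (a ⊔ t ≤ α ∧ α.degree ≤ d) ∧ ∀ u ∈ T, ¬ u ≤ α} ⊆
        {α | (a ≤ α ∧ α.degree ≤ d) ∧ ∀ u ∈ T, ¬ u ≤ α} :=
      fun α h => ⟨⟨le_sup_left.trans h.1.1, h.1.2⟩, h.2⟩
    rw [hset, Set.ncard_sdiff hsub (hfin _), Nat.cast_sub (Set.ncard_le_ncard hsub (hfin _)),
      h₁, h₂, Polynomial.eval_sub]

/-- By Dickson's lemma, only finitely many elements of `U` matter. -/
theorem exists_poly_ncard_degree_le_of_forall_not_le {s : ℕ} (U : Set (Fin s →₀ ℕ)) :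
    ∃ H : Polynomial ℚ, ∀ᶠ d : ℕ in atTop,
      ({α : Fin s →₀ ℕ | α.degree ≤ d ∧ ∀ t ∈ U, ¬ t ≤ α}.ncard : ℚ) = H.eval (d : ℚ) := by
  have hfin : {t | Minimal (· ∈ U) t}.Finite :=
    WellQuasiOrderedLE.finite_of_isAntichain (setOfPred_minimal_antichain _)
  obtain ⟨H, h⟩ := exists_poly_ncard_ge_of_finset hfin.toFinset 0
  refine ⟨H, h.mono fun d hd => ?_⟩
  rw [← hd]
  congr 2
  ext α
  simp only [Set.mem_ofPred_eq, zero_le, true_and, Set.Finite.mem_toFinset]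
  refine and_congr_right fun _ => ⟨fun h t ht => h t ht.1, fun h t ht hle => ?_⟩
  obtain ⟨m, hm, hmin⟩ := (Set.isPWO_of_wellQuasiOrderedLE U).exists_le_minimal ht
  exact h m hmin (hm.trans hle)

/-! ### Degrees of polynomials bounded on the natural numbers -/

/-- If the degree of `P` were larger, `Q / P` would tend to zero, although it is at least `1` at
large natural numbers. -/
theorem natDegree_le_of_eventually_eval_natCast_le {P Q : Polynomial ℚ}
    (h : ∀ᶠ n : ℕ in atTop, 0 ≤ P.eval (n : ℚ) ∧ P.eval (n : ℚ) ≤ Q.eval (n : ℚ)) :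
    P.natDegree ≤ Q.natDegree := by
  by_contra! hlt
  have hP : P ≠ 0 := by
    rintro rfl
    simp at hlt
  have hdeg : Q.degree < P.degree := Polynomial.degree_lt_degree hlt
  have ht := (Polynomial.div_tendsto_atTop_zero_of_degree_lt Q P hdeg).comp
    (tendsto_natCast_atTop_atTop (R := ℚ))
  have hne := (tendsto_natCast_atTop_atTop (R := ℚ)).eventually
    (Polynomial.eventually_atTop_not_isRoot P hP)
  have hlt1 := ht.eventually_lt_const (zero_lt_one)
  obtain ⟨n, ⟨h0, hle⟩, hn, h1⟩ := (h.and (hne.and hlt1)).exists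
  have hpos : 0 < P.eval (n : ℚ) := lt_of_le_of_ne h0 (Ne.symm hn)
  simp only [Function.comp_apply] at h1
  rw [div_lt_one hpos] at h1
  exact absurd hle h1.not_ge

/-! ### The Hilbert function counts standard monomials -/

section HilbertFunction

variable {k : Type*} [Field k] {p : ℕ}

/-- The classes in `k[X] / I` of the polynomials of total degree at most `d`. -/
noncomputable def degreeFiltration (I : Ideal (MvPolynomial (Fin p) k)) (d : ℕ) :
    Submodule k (MvPolynomial (Fin p) k ⧸ I) :=
  (MvPolynomial.restrictTotalDegree (Fin p) k d).map (Ideal.Quotient.mkₐ k I).toLinearMap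

theorem mem_degreeFiltration {I : Ideal (MvPolynomial (Fin p) k)} {d : ℕ}
    {x : MvPolynomial (Fin p) k ⧸ I} :
    x ∈ degreeFiltration I d ↔ ∃ P : MvPolynomial (Fin p) k, P.totalDegree ≤ d ∧
      Ideal.Quotient.mkₐ k I P = x := by
  simp [degreeFiltration, Submodule.mem_map, MvPolynomial.mem_restrictTotalDegree]

/-- The leading exponents, for the degree lexicographic order, of the nonzero elements of `I`. -/
def leadingExponents (I : Ideal (MvPolynomial (Fin p) k)) : Set (Fin p →₀ ℕ) :=
  {α | ∃ f ∈ I, f ≠ 0 ∧ MonomialOrder.degLex.degree f = α}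

/-- The exponents of degree at most `d` of the standard monomials of `I`: those that are not
divisible by a leading monomial of `I`. -/
def standardExponents (I : Ideal (MvPolynomial (Fin p) k)) (d : ℕ) : Set (Fin p →₀ ℕ) :=
  {α | α.degree ≤ d ∧ ∀ t ∈ leadingExponents I, ¬ t ≤ α}

theorem sum_eq_degree {σ : Type*} (α : σ →₀ ℕ) : (α.sum fun _ e => e) = α.degree := rfl

/-- Every polynomial is congruent modulo `I` to its remainder on division by the nonzero elements
of `I`; the degree does not increase because the monomial order is graded. -/
theorem exists_standard_representative (I : Ideal (MvPolynomial (Fin p) k)) {d : ℕ}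
    {P : MvPolynomial (Fin p) k} (hP : P.totalDegree ≤ d) :
    ∃ r ∈ MvPolynomial.restrictSupport k (standardExponents I d), P - r ∈ I := by
  obtain ⟨g, r, hg, hdeg, hr⟩ := MonomialOrder.degLex.div_set
    (B := {f : MvPolynomial (Fin p) k | f ∈ I ∧ f ≠ 0})
    (fun b hb => (MonomialOrder.degLex.leadingCoeff_ne_zero_iff.2 hb.2).isUnit) P
  have hPr : P - r = Finsupp.linearCombination _ (fun b : {f | f ∈ I ∧ f ≠ 0} =>
      (b : MvPolynomial (Fin p) k)) g := by
    rw [hg]; ring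
  have hr' : r.totalDegree ≤ d := by
    rw [show r = P - (P - r) by ring]
    refine (MvPolynomial.totalDegree_sub _ _).trans (max_le hP ?_)
    rw [hPr, Finsupp.linearCombination_apply]
    refine MvPolynomial.totalDegree_finsetSum_le fun b _ => ?_
    change (g b * (b : MvPolynomial (Fin p) k)).totalDegree ≤ d
    rw [mul_comm]
    exact (MvPolynomial.degLex_totalDegree_monotone (hdeg b)).trans hP
  refine ⟨r, ?_, ?_⟩
  · rw [MvPolynomial.mem_restrictSupport_iff]
    intro α hα
    refine ⟨?_, ?_⟩
    · rw [← sum_eq_degree]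
      exact (MvPolynomial.le_totalDegree hα).trans hr'
    · rintro _ ⟨f, hf, hf0, rfl⟩
      exact hr α hα f ⟨hf, hf0⟩
  · rw [hPr, Finsupp.linearCombination_apply]
    exact I.sum_mem fun b _ => I.mul_mem_left _ b.2.1

theorem finrank_degreeFiltration (I : Ideal (MvPolynomial (Fin p) k)) (d : ℕ) :
    Module.finrank k (degreeFiltration I d) = (standardExponents I d).ncard := by
  set π := (Ideal.Quotient.mkₐ k I).toLinearMap
  set N := MvPolynomial.restrictSupport k (standardExponents I d) with hN
  have hmap : degreeFiltration I d = N.map π := by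
    apply le_antisymm
    · rintro _ ⟨P, hP, rfl⟩
      rw [SetLike.mem_coe, MvPolynomial.mem_restrictTotalDegree] at hP
      obtain ⟨r, hr, hPr⟩ := exists_standard_representative I hP
      exact ⟨r, hr, ((Ideal.Quotient.mk_eq_mk_iff_sub_mem _ _).2 hPr).symm⟩
    · refine Submodule.map_mono fun P hP => ?_
      rw [MvPolynomial.mem_restrictTotalDegree]
      rw [hN, MvPolynomial.mem_restrictSupport_iff] at hP
      exact Finset.sup_le fun α hα => (hP hα).1
  have hinj : Function.Injective (π.domRestrict N) := by
    rw [injective_iff_map_eq_zero]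
    rintro ⟨P, hP⟩ h0
    have hPI : P ∈ I := Ideal.Quotient.eq_zero_iff_mem.1 h0
    -- Otherwise the leading exponent of `P` would be both standard and a leading exponent of `I`.
    by_contra hne
    have hP0 : P ≠ 0 := fun h => hne (Subtype.ext h)
    rw [hN, MvPolynomial.mem_restrictSupport_iff] at hP
    exact (hP (MonomialOrder.degLex.degree_mem_support hP0)).2 _ ⟨P, hPI, hP0, rfl⟩ le_rfl
  rw [hmap, ← LinearMap.range_domRestrict, LinearMap.finrank_range_of_inj hinj,
    Module.finrank_eq_nat_card_basis (MvPolynomial.basisRestrictSupport k _)]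
  rfl

theorem finrank_restrictTotalDegree (s d : ℕ) :
    Module.finrank k (MvPolynomial.restrictTotalDegree (Fin s) k d) = (d + s).choose d := by
  rw [MvPolynomial.restrictTotalDegree,
    Module.finrank_eq_nat_card_basis (MvPolynomial.basisRestrictSupport k _), ← ncard_degree_le]
  rfl

theorem exists_hilbertPolynomial (I : Ideal (MvPolynomial (Fin p) k)) :
    ∃ H : Polynomial ℚ, ∀ᶠ d : ℕ in atTop,
      (Module.finrank k (degreeFiltration I d) : ℚ) = H.eval (d : ℚ) := by
  simp only [finrank_degreeFiltration]
  exact exists_poly_ncard_degree_le_of_forall_not_le (leadingExponents I)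

/-! ### Growth of the Hilbert function -/

instance (I : Ideal (MvPolynomial (Fin p) k)) (d : ℕ) :
    Module.Finite k (degreeFiltration I d) := by
  unfold degreeFiltration
  infer_instance

theorem degreeFiltration_mono (I : Ideal (MvPolynomial (Fin p) k)) :
    Monotone (degreeFiltration I) := by
  intro a b hab x hx
  rw [mem_degreeFiltration] at hx ⊢
  obtain ⟨P, hP, rfl⟩ := hx
  exact ⟨P, hP.trans hab, rfl⟩

theorem mul_mem_degreeFiltration {I : Ideal (MvPolynomial (Fin p) k)} {a b : ℕ}
    {x y : MvPolynomial (Fin p) k ⧸ I} (hx : x ∈ degreeFiltration I a)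
    (hy : y ∈ degreeFiltration I b) : x * y ∈ degreeFiltration I (a + b) := by
  rw [mem_degreeFiltration] at hx hy ⊢
  obtain ⟨P, hP, rfl⟩ := hx
  obtain ⟨Q, hQ, rfl⟩ := hy
  exact ⟨P * Q, (MvPolynomial.totalDegree_mul P Q).trans (add_le_add hP hQ), map_mul _ _ _⟩

theorem prod_pow_mem_degreeFiltration {I : Ideal (MvPolynomial (Fin p) k)} {s e : ℕ}
    {x : Fin s → MvPolynomial (Fin p) k ⧸ I} (hx : ∀ i, x i ∈ degreeFiltration I e)
    (α : Fin s →₀ ℕ) : ∏ i, x i ^ α i ∈ degreeFiltration I (e * α.degree) := by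
  have hpow (i : Fin s) (n : ℕ) : x i ^ n ∈ degreeFiltration I (e * n) := by
    induction n with
    | zero => exact mem_degreeFiltration.2 ⟨1, by simp, by simp⟩
    | succ n ih => rw [pow_succ, mul_add, mul_one]; exact mul_mem_degreeFiltration ih (hx i)
  rw [Finsupp.degree_eq_sum, Finset.mul_sum]
  induction (Finset.univ : Finset (Fin s)) using Finset.induction_on with
  | empty => exact mem_degreeFiltration.2 ⟨1, by simp, by simp⟩
  | insert i t hi ih =>
    rw [Finset.prod_insert hi, Finset.sum_insert hi]
    exact mul_mem_degreeFiltration (hpow i _) ih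

/-- An embedded polynomial ring in `s` variables forces growth of order at least `s`: polynomials
of degree `d` in the images of the variables have degree at most `e * d`. -/
theorem exists_choose_le_finrank_degreeFiltration {I : Ideal (MvPolynomial (Fin p) k)} {s : ℕ}
    {g : MvPolynomial (Fin s) k →ₐ[k] MvPolynomial (Fin p) k ⧸ I} (hg : Function.Injective g) :
    ∃ e : ℕ, 0 < e ∧ ∀ d : ℕ,
      (d + s).choose d ≤ Module.finrank k (degreeFiltration I (e * d)) := by
  choose P hP using fun i => Ideal.Quotient.mkₐ_surjective k I (g (MvPolynomial.X i))
  -- A bound for the degrees of representatives of the images of the variables; the summand `1`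
  -- keeps it positive when `s = 0`.
  set e := Finset.univ.sup (fun i => (P i).totalDegree) + 1
  have hX (i : Fin s) : g (MvPolynomial.X i) ∈ degreeFiltration I e :=
    mem_degreeFiltration.2 ⟨P i, (Finset.le_sup (f := fun i => (P i).totalDegree)
      (Finset.mem_univ i)).trans (Nat.le_succ _), hP i⟩
  refine ⟨e, Nat.succ_pos _, fun d => ?_⟩
  have hle : (MvPolynomial.restrictTotalDegree (Fin s) k d).map g.toLinearMap ≤
      degreeFiltration I (e * d) := by
    rintro _ ⟨Q, hQ, rfl⟩
    rw [SetLike.mem_coe, MvPolynomial.mem_restrictTotalDegree] at hQ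
    rw [AlgHom.toLinearMap_apply, Q.as_sum, map_sum]
    refine Submodule.sum_mem _ fun α hα => ?_
    have hd : α.degree ≤ d := by
      rw [← sum_eq_degree]
      exact (MvPolynomial.le_totalDegree hα).trans hQ
    have hmon : g (MvPolynomial.monomial α (Q.coeff α)) =
        Q.coeff α • ∏ i, g (MvPolynomial.X i) ^ α i := by
      rw [MvPolynomial.monomial_eq, ← MvPolynomial.smul_eq_C_mul, map_smul,
        Finsupp.prod_fintype _ _ (by simp), map_prod]
      simp only [map_pow]
    rw [hmon]
    exact Submodule.smul_mem _ _
      (degreeFiltration_mono I (Nat.mul_le_mul_left e hd) (prod_pow_mem_degreeFiltration hX α))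
  rw [← finrank_restrictTotalDegree (k := k),
    (Submodule.equivMapOfInjective g.toLinearMap hg _).finrank_eq]
  exact Submodule.finrank_mono hle

theorem exists_generators_of_finite {R A : Type*} [CommRing R] [CommRing A] {g : R →+* A}
    (hg : g.Finite) :
    ∃ (m : ℕ) (w : Fin m → A), ∀ x, ∃ c : Fin m → R, ∑ j, g (c j) * w j = x := by
  algebraize [g]
  obtain ⟨m, w, hw⟩ := Module.Finite.exists_fin (R := R) (M := A)
  refine ⟨m, w, fun x => ?_⟩
  obtain ⟨c, hc⟩ := (Submodule.mem_span_range_iff_exists_fun R).1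
    (hw ▸ Submodule.mem_top : x ∈ Submodule.span R (Set.range w))
  exact ⟨c, by simpa [Algebra.smul_def, RingHom.algebraMap_toAlgebra] using hc⟩

/-- Let `w` generate `k[X] / I` as a module over a polynomial ring in `s` variables. Multiplication
by a variable of `k[X]` is given in these generators by a matrix of polynomials of degree at most
some `e`, so a class of degree `d` has coordinates of degree at most `e * d + e`. -/
theorem exists_finrank_degreeFiltration_le {I : Ideal (MvPolynomial (Fin p) k)} {s : ℕ}
    {g : MvPolynomial (Fin s) k →ₐ[k] MvPolynomial (Fin p) k ⧸ I} (hg : g.Finite) :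
    ∃ m e : ℕ, ∀ d : ℕ, Module.finrank k (degreeFiltration I d) ≤
      m * (e * d + e + s).choose (e * d + e) := by
  obtain ⟨m, w, hw⟩ : ∃ (m : ℕ) (w : Fin m → MvPolynomial (Fin p) k ⧸ I),
      ∀ x, ∃ c : Fin m → MvPolynomial (Fin s) k, ∑ j, g (c j) * w j = x :=
    exists_generators_of_finite hg
  let π := Ideal.Quotient.mkₐ k I
  choose a ha using fun (i : Fin p) (j : Fin m) => hw (π (MvPolynomial.X i) * w j)
  obtain ⟨b, hb⟩ := hw 1
  -- `e` bounds the degrees of all matrix entries and of the coordinates of `1`.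
  set e := (Finset.univ.sup fun i => Finset.univ.sup fun j => Finset.univ.sup fun l =>
    (a i j l).totalDegree) + Finset.univ.sup fun j => (b j).totalDegree
  have hae (i : Fin p) (j l : Fin m) : (a i j l).totalDegree ≤ e := by
    refine le_trans ?_ (Nat.le_add_right _ _)
    exact (Finset.le_sup (f := fun l => (a i j l).totalDegree) (Finset.mem_univ l)).trans
      ((Finset.le_sup (f := fun j => Finset.univ.sup fun l => (a i j l).totalDegree)
        (Finset.mem_univ j)).trans
      (Finset.le_sup (f := fun i => Finset.univ.sup fun j => Finset.univ.sup fun l =>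
        (a i j l).totalDegree) (Finset.mem_univ i)))
  have hbe (j : Fin m) : (b j).totalDegree ≤ e :=
    (Finset.le_sup (f := fun j => (b j).totalDegree) (Finset.mem_univ j)).trans
      (Nat.le_add_left _ _)
  have hmon (n : ℕ) : ∀ α : Fin p →₀ ℕ, α.degree = n → ∃ c : Fin m → MvPolynomial (Fin s) k,
      (∀ j, (c j).totalDegree ≤ e * n + e) ∧
        ∑ j, g (c j) * w j = π (MvPolynomial.monomial α 1) := by
    induction n with
    | zero =>
      intro α hα
      rw [Finsupp.degree_eq_zero_iff] at hα
      subst hα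
      refine ⟨b, fun j => by simpa using hbe j, ?_⟩
      rw [hb, ← MvPolynomial.one_def, map_one]
    | succ n ih =>
      intro α hα
      obtain ⟨i, hi⟩ : ∃ i, α i ≠ 0 := by
        by_contra! h
        rw [Finsupp.degree_eq_sum, Finset.sum_eq_zero fun i _ => h i] at hα
        omega
      have hle : Finsupp.single i 1 ≤ α := by
        rw [Finsupp.single_le_iff]
        omega
      obtain ⟨β, rfl⟩ := exists_add_of_le hle
      rw [map_add, Finsupp.degree_single] at hα
      obtain ⟨c, hc, hcw⟩ := ih β (by omega)
      refine ⟨fun l => ∑ j, c j * a i j l, fun l => ?_, ?_⟩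
      · refine MvPolynomial.totalDegree_finsetSum_le fun j _ => ?_
        refine (MvPolynomial.totalDegree_mul _ _).trans ?_
        have := add_le_add (hc j) (hae i j l)
        rw [mul_add]
        omega
      · have hX : (MvPolynomial.monomial (Finsupp.single i 1 + β) 1 : MvPolynomial (Fin p) k) =
            MvPolynomial.X i * MvPolynomial.monomial β 1 := by
          rw [MvPolynomial.X, MvPolynomial.monomial_mul, one_mul]
        rw [hX, map_mul, ← hcw, Finset.mul_sum]
        simp only [map_sum, map_mul, Finset.sum_mul]
        rw [Finset.sum_comm]
        refine Finset.sum_congr rfl fun j _ => ?_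
        rw [mul_left_comm, ← ha, Finset.mul_sum]
        exact Finset.sum_congr rfl fun l _ => mul_assoc _ _ _
  refine ⟨m, e, fun d => ?_⟩
  -- The classes of degree at most `d` lie in the image of the coordinate tuples of degree at most
  -- `e * d + e`, whose dimension is the bound.
  let Φ : (Fin m → MvPolynomial.restrictTotalDegree (Fin s) k (e * d + e)) →ₗ[k]
      MvPolynomial (Fin p) k ⧸ I :=
    LinearMap.lsum k _ k fun j =>
      (LinearMap.mulRight k (w j)).comp (g.toLinearMap.comp (Submodule.subtype _))
  have hΦ : degreeFiltration I d ≤ LinearMap.range Φ := by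
    rintro _ ⟨Q, hQ, rfl⟩
    rw [SetLike.mem_coe, MvPolynomial.mem_restrictTotalDegree] at hQ
    rw [AlgHom.toLinearMap_apply, Q.as_sum, map_sum]
    refine Submodule.sum_mem _ fun α hα => ?_
    have hd : α.degree ≤ d := by
      rw [← sum_eq_degree]
      exact (MvPolynomial.le_totalDegree hα).trans hQ
    have hsmul : MvPolynomial.monomial α (Q.coeff α) =
        Q.coeff α • MvPolynomial.monomial α (1 : k) := by
      rw [MvPolynomial.smul_monomial, smul_eq_mul, mul_one]
    rw [hsmul, map_smul]
    refine Submodule.smul_mem _ _ ?_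
    obtain ⟨c, hc, hcw⟩ := hmon _ α rfl
    refine ⟨fun j => ⟨c j, ?_⟩, ?_⟩
    · rw [MvPolynomial.mem_restrictTotalDegree]
      exact (hc j).trans (by gcongr)
    · rw [← hcw]
      simp [Φ, LinearMap.lsum_apply]
  calc Module.finrank k (degreeFiltration I d)
      ≤ Module.finrank k (LinearMap.range Φ) := Submodule.finrank_mono hΦ
    _ ≤ Module.finrank k
        (Fin m → MvPolynomial.restrictTotalDegree (Fin s) k (e * d + e)) :=
      LinearMap.finrank_range_le Φ
    _ = m * (e * d + e + s).choose (e * d + e) := by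
      rw [Module.finrank_pi_fintype]
      simp [finrank_restrictTotalDegree]

/-- **Hilbert polynomial of an affine algebra.** By Noether normalization `k[X] / I` is finite over
a polynomial ring in `s` variables, so `s` is its Krull dimension; the two growth bounds then force
the Hilbert polynomial to have degree `s`. -/
theorem exists_hilbertPolynomial_natDegree_eq {I : Ideal (MvPolynomial (Fin p) k)} (hI : I ≠ ⊤) :
    ∃ H : Polynomial ℚ,
      (H.natDegree : WithBot ℕ∞) = ringKrullDim (MvPolynomial (Fin p) k ⧸ I) ∧
      ∀ᶠ d : ℕ in atTop, (Module.finrank k (degreeFiltration I d) : ℚ) = H.eval (d : ℚ) := by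
  have : Nontrivial (MvPolynomial (Fin p) k ⧸ I) := Ideal.Quotient.nontrivial_iff.2 hI
  obtain ⟨s, g, hinj, hfin⟩ := exists_finite_inj_algHom_of_fg k (MvPolynomial (Fin p) k ⧸ I)
  have hdim : ringKrullDim (MvPolynomial (Fin p) k ⧸ I) = s := by
    let _ : Algebra (MvPolynomial (Fin s) k) (MvPolynomial (Fin p) k ⧸ I) := g.toRingHom.toAlgebra
    have : Algebra.IsIntegral (MvPolynomial (Fin s) k) (MvPolynomial (Fin p) k ⧸ I) :=
      ⟨RingHom.Finite.to_isIntegral hfin⟩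
    rw [Algebra.IsIntegral.ringKrullDim_eq (MvPolynomial (Fin s) k) _ hinj,
      MvPolynomial.ringKrullDim_of_isNoetherianRing]
    simp
  obtain ⟨H, hH⟩ := exists_hilbertPolynomial I
  refine ⟨H, ?_, hH⟩
  rw [hdim]
  norm_cast
  let B := Polynomial.preHilbertPoly ℚ s 0
  have hB : B.natDegree = s := Polynomial.natDegree_preHilbertPoly ℚ s 0
  apply le_antisymm
  · obtain ⟨m, e, hme⟩ := exists_finrank_degreeFiltration_le hfin
    have hle : H.natDegree ≤ (Polynomial.C (m : ℚ) *
        B.comp (Polynomial.C (e : ℚ) * Polynomial.X + Polynomial.C (e : ℚ))).natDegree := by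
      refine natDegree_le_of_eventually_eval_natCast_le (hH.mono fun d hd => ?_)
      rw [← hd]
      refine ⟨Nat.cast_nonneg _, ?_⟩
      have h := eval_preHilbertPoly_zero s (e * d + e)
      push_cast at h
      simp only [Polynomial.eval_mul, Polynomial.eval_comp, Polynomial.eval_add,
        Polynomial.eval_C, Polynomial.eval_X, B, h]
      exact_mod_cast hme d
    refine hle.trans ((Polynomial.natDegree_C_mul_le _ _).trans ?_)
    rw [Polynomial.natDegree_comp, hB]
    exact mul_le_of_le_one_right (Nat.zero_le _) Polynomial.natDegree_linear_le
  · obtain ⟨e, he, hle⟩ := exists_choose_le_finrank_degreeFiltration hinj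
    have hle' : B.natDegree ≤ (H.comp (Polynomial.C (e : ℚ) * Polynomial.X)).natDegree := by
      refine natDegree_le_of_eventually_eval_natCast_le ?_
      have htend : Tendsto (fun d : ℕ => e * d) atTop atTop :=
        tendsto_id.const_mul_atTop' he
      filter_upwards [htend.eventually hH] with d hd
      rw [eval_preHilbertPoly_zero]
      refine ⟨Nat.cast_nonneg _, ?_⟩
      push_cast at hd
      simp only [Polynomial.eval_comp, Polynomial.eval_mul, Polynomial.eval_C, Polynomial.eval_X]
      rw [← hd]
      exact_mod_cast hle d
    rw [hB, Polynomial.natDegree_comp] at hle'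
    refine hle'.trans (mul_le_of_le_one_right (Nat.zero_le _) ?_)
    exact (Polynomial.natDegree_C_mul_le _ _).trans Polynomial.natDegree_X_le

end HilbertFunction

/-! ### Polynomials vanishing on the support -/

section Support

open MeasureTheory

variable {p : ℕ} {μ : Measure (Fin p → ℝ)}

theorem mem_vanishingIdeal_zariskiClosure {S : Set (Fin p → ℝ)} {P : MvPolynomial (Fin p) ℝ} :
    P ∈ MvPolynomial.vanishingIdeal ℝ (zariskiClosure S) ↔ ∀ x ∈ S, MvPolynomial.eval x P = 0 := by
  simp only [MvPolynomial.mem_vanishingIdeal_iff, MvPolynomial.aeval_eq_eval]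
  constructor
  · exact fun h x hx => h x (Set.mem_sInter.2 fun W hW => hW.2 hx)
  · intro h x hx
    have hW : IsAlgebraicSet {y : Fin p → ℝ | MvPolynomial.eval y P = 0} := ⟨{P}, by simp⟩
    exact Set.mem_sInter.1 hx _ ⟨hW, h⟩

theorem eval_monomial_eq (x : Fin p → ℝ) (α : Fin p →₀ ℕ) (c : ℝ) :
    MvPolynomial.eval x (MvPolynomial.monomial α c) = c * monomialValue α x := by
  rw [MvPolynomial.eval_monomial, Finsupp.prod_fintype _ _ (by simp), monomialValue]

theorem HasFiniteMoments.integrable_eval (hμ : HasFiniteMoments μ) (P : MvPolynomial (Fin p) ℝ) :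
    Integrable (fun x => MvPolynomial.eval x P) μ := by
  have heq : (fun x => MvPolynomial.eval x P) =
      fun x => ∑ α ∈ P.support, P.coeff α * monomialValue α x := by
    ext x
    conv_lhs => rw [P.as_sum, map_sum]
    simp only [eval_monomial_eq]
  rw [heq]
  exact integrable_finsetSum _ fun α _ => (hμ α).const_mul _

/-- The set where a polynomial vanishes is closed, so it has full measure exactly when it contains
the support. -/
theorem ae_eval_eq_zero_iff {P : MvPolynomial (Fin p) ℝ} :
    (∀ᵐ x ∂μ, MvPolynomial.eval x P = 0) ↔ ∀ x ∈ μ.support, MvPolynomial.eval x P = 0 := by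
  constructor
  · intro h
    exact Measure.support_subset_of_isClosed
      (isClosed_eq (MvPolynomial.continuous_eval P) continuous_const) h
  · intro h
    filter_upwards [Measure.support_mem_ae (μ := μ)] with x hx using h x hx

theorem HasFiniteMoments.integral_eval_sq_eq_zero_iff (hμ : HasFiniteMoments μ)
    {P : MvPolynomial (Fin p) ℝ} :
    ∫ x, MvPolynomial.eval x P ^ 2 ∂μ = 0 ↔
      P ∈ MvPolynomial.vanishingIdeal ℝ (zariskiClosure μ.support) := by
  have hint : Integrable (fun x => MvPolynomial.eval x P ^ 2) μ :=
    (hμ.integrable_eval (P ^ 2)).congr (.of_forall fun x => map_pow _ _ _)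
  rw [mem_vanishingIdeal_zariskiClosure, ← ae_eval_eq_zero_iff,
    integral_eq_zero_iff_of_nonneg (fun x => sq_nonneg _) hint]
  exact eventually_congr (.of_forall fun x => by simp)

end Support

/-! ### The kernel and the rank of the moment matrix -/

section MomentMatrix

open MeasureTheory

variable {p : ℕ} {μ : Measure (Fin p → ℝ)}

/-- `polyOfCoeffs` as a linear map. -/
noncomputable def polyOfCoeffsLinear (p d : ℕ) :
    (Exponent p d → ℝ) →ₗ[ℝ] MvPolynomial (Fin p) ℝ where
  toFun := polyOfCoeffs
  map_add' c c' := by simp [polyOfCoeffs, Finset.sum_add_distrib]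
  map_smul' r c := by simp [polyOfCoeffs, Finset.smul_sum, MvPolynomial.smul_monomial]

theorem range_polyOfCoeffsLinear (p d : ℕ) :
    LinearMap.range (polyOfCoeffsLinear p d) =
      MvPolynomial.restrictTotalDegree (Fin p) ℝ d := by
  apply le_antisymm
  · rintro _ ⟨c, rfl⟩
    refine Submodule.sum_mem _ fun α _ => ?_
    rw [MvPolynomial.mem_restrictTotalDegree]
    exact (MvPolynomial.totalDegree_monomial_le _ _).trans α.2
  · intro P hP
    rw [MvPolynomial.mem_restrictTotalDegree] at hP
    refine ⟨fun α => P.coeff α.1, ?_⟩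
    ext β
    change MvPolynomial.coeff β (∑ α : Exponent p d, MvPolynomial.monomial α.1 (P.coeff α.1)) = _
    classical
    simp only [MvPolynomial.coeff_sum, MvPolynomial.coeff_monomial]
    by_cases hβ : β.degree ≤ d
    · rw [Finset.sum_eq_single (⟨β, hβ⟩ : Exponent p d)]
      · simp
      · intro α _ hα
        rw [if_neg fun h => hα (Subtype.ext h)]
      · simp
    · rw [Finset.sum_eq_zero fun α _ => if_neg fun h : α.1 = β => hβ (h ▸ α.2), eq_comm]
      by_contra hne
      exact hβ ((MvPolynomial.le_totalDegree (MvPolynomial.mem_support_iff.2 hne)).trans hP)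

theorem eval_polyOfCoeffs {d : ℕ} (c : Exponent p d → ℝ) (x : Fin p → ℝ) :
    MvPolynomial.eval x (polyOfCoeffs c) = ∑ α, c α * monomialValue α.1 x := by
  simp [polyOfCoeffs, eval_monomial_eq]

theorem HasFiniteMoments.momentMatrix_mulVec (hμ : HasFiniteMoments μ) {d : ℕ}
    (c : Exponent p d → ℝ) (α : Exponent p d) :
    (momentMatrix μ d).mulVec c α =
      ∫ x, monomialValue α.1 x * MvPolynomial.eval x (polyOfCoeffs c) ∂μ := by
  have hint (β : Exponent p d) :
      Integrable (fun x => monomialValue α.1 x * monomialValue β.1 x * c β) μ := by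
    have h := hμ.integrable_eval (MvPolynomial.monomial α.1 1 * MvPolynomial.monomial β.1 (c β))
    simp only [map_mul, eval_monomial_eq, one_mul] at h
    exact h.congr (.of_forall fun x => by ring)
  simp only [Matrix.mulVec, dotProduct, momentMatrix, Matrix.of_apply, eval_polyOfCoeffs,
    ← integral_mul_const]
  rw [← integral_finsetSum _ fun β _ => hint β]
  congr 1 with x
  rw [Finset.mul_sum]
  exact Finset.sum_congr rfl fun β _ => by ring

theorem HasFiniteMoments.dotProduct_momentMatrix_mulVec (hμ : HasFiniteMoments μ) {d : ℕ}
    (c : Exponent p d → ℝ) :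
    c ⬝ᵥ (momentMatrix μ d).mulVec c = ∫ x, MvPolynomial.eval x (polyOfCoeffs c) ^ 2 ∂μ := by
  have hint (α : Exponent p d) : Integrable
      (fun x => c α * (monomialValue α.1 x * MvPolynomial.eval x (polyOfCoeffs c))) μ := by
    have h := hμ.integrable_eval (MvPolynomial.monomial α.1 (c α) * polyOfCoeffs c)
    simp only [map_mul, eval_monomial_eq] at h
    exact h.congr (.of_forall fun x => by ring)
  simp only [dotProduct, hμ.momentMatrix_mulVec, ← integral_const_mul]
  rw [← integral_finsetSum _ fun α _ => hint α]
  congr 1 with x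
  rw [sq]
  nth_rewrite 2 [eval_polyOfCoeffs]
  rw [Finset.sum_mul]
  exact Finset.sum_congr rfl fun α _ => by ring

/-- The quadratic form of the moment matrix is `c ↦ ∫ ⟨c, v_d⟩² dμ`, and a vector on which this
form vanishes is in the kernel because the polynomial is then zero almost everywhere. -/
theorem HasFiniteMoments.mem_momentKernel_iff (hμ : HasFiniteMoments μ) {d : ℕ}
    {c : Exponent p d → ℝ} :
    c ∈ momentKernel μ d ↔
      polyOfCoeffs c ∈ MvPolynomial.vanishingIdeal ℝ (zariskiClosure μ.support) := by
  rw [momentKernel, LinearMap.mem_ker, Matrix.mulVecLin_apply]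
  constructor
  · intro h
    rw [← hμ.integral_eval_sq_eq_zero_iff, ← hμ.dotProduct_momentMatrix_mulVec, h,
      dotProduct_zero]
  · intro h
    rw [mem_vanishingIdeal_zariskiClosure, ← ae_eval_eq_zero_iff (μ := μ)] at h
    ext α
    rw [hμ.momentMatrix_mulVec, Pi.zero_apply]
    refine integral_eq_zero_of_ae (h.mono fun x hx => ?_)
    simp [hx]

/-- Both sides are ranks of linear maps on coefficient vectors with the same kernel. -/
theorem HasFiniteMoments.rank_momentMatrix (hμ : HasFiniteMoments μ) (d : ℕ) :
    (momentMatrix μ d).rank = Module.finrank ℝ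
      (degreeFiltration (MvPolynomial.vanishingIdeal ℝ (zariskiClosure μ.support)) d) := by
  set I := MvPolynomial.vanishingIdeal ℝ (zariskiClosure μ.support)
  set φ := (Ideal.Quotient.mkₐ ℝ I).toLinearMap.comp (polyOfCoeffsLinear p d) with hφ
  have hker : LinearMap.ker φ = LinearMap.ker (momentMatrix μ d).mulVecLin := by
    ext c
    rw [← momentKernel, hμ.mem_momentKernel_iff]
    exact Ideal.Quotient.eq_zero_iff_mem
  have hrange : LinearMap.range φ = degreeFiltration I d := by
    rw [hφ, LinearMap.range_comp, range_polyOfCoeffsLinear, degreeFiltration]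
  have h₁ := LinearMap.finrank_range_add_finrank_ker φ
  have h₂ := LinearMap.finrank_range_add_finrank_ker (momentMatrix μ d).mulVecLin
  rw [hker, hrange] at h₁
  rw [Matrix.rank]
  omega

theorem finrank_quotient_comap_ker {K M N : Type*} [Field K] [AddCommGroup M] [Module K M]
    [AddCommGroup N] [Module K N] (f : M →ₗ[K] N) (W : Submodule K M) :
    Module.finrank K (W ⧸ (LinearMap.ker f).comap W.subtype) = Module.finrank K (W.map f) := by
  rw [← LinearMap.range_domRestrict]
  exact (f.domRestrict W).quotKerEquivRange.finrank_eq

theorem hilbertFunction_eq_finrank_degreeFiltration (I : Ideal (MvPolynomial (Fin p) ℝ)) (d : ℕ) :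
    hilbertFunction I d = Module.finrank ℝ (degreeFiltration I d) := by
  have hker : LinearMap.ker (Ideal.Quotient.mkₐ ℝ I).toLinearMap = I.restrictScalars ℝ := by
    ext P
    exact Ideal.Quotient.eq_zero_iff_mem
  rw [hilbertFunction, degreeFiltration, ← hker, finrank_quotient_comap_ker]

theorem hilbertFunction_vanishingIdeal (V : Set (Fin p → ℝ)) (d : ℕ) :
    hilbertFunction (MvPolynomial.vanishingIdeal ℝ V) d =
      Module.finrank ℝ (polynomialFunctions V d) := by
  have hker : LinearMap.ker (restrictTo V) =
      (MvPolynomial.vanishingIdeal ℝ V).restrictScalars ℝ := by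
    ext P
    simp [restrictTo, funext_iff, MvPolynomial.mem_vanishingIdeal_iff, MvPolynomial.aeval_eq_eval]
  rw [hilbertFunction, polynomialFunctions, ← hker, finrank_quotient_comap_ker]

theorem vanishingIdeal_zariskiClosure_ne_top {S : Set (Fin p → ℝ)} (hS : S.Nonempty) :
    MvPolynomial.vanishingIdeal ℝ (zariskiClosure S) ≠ ⊤ := by
  obtain ⟨x, hx⟩ := hS
  rw [Ideal.ne_top_iff_one, mem_vanishingIdeal_zariskiClosure]
  exact fun h => by simpa using h x hx

/-! ### Generation of the vanishing ideal -/

/-- The polynomials of the kernel are the elements of the vanishing ideal of degree at most `d`,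
and a Noetherian ideal is generated by its elements of bounded degree. -/
theorem HasFiniteMoments.eventually_span_momentKernel (hμ : HasFiniteMoments μ) :
    ∀ᶠ d : ℕ in atTop, Ideal.span (polyOfCoeffs '' (momentKernel μ d : Set (Exponent p d → ℝ))) =
      MvPolynomial.vanishingIdeal ℝ (zariskiClosure μ.support) := by
  obtain ⟨T, hT⟩ := IsNoetherian.noetherian
    (MvPolynomial.vanishingIdeal ℝ (zariskiClosure μ.support))
  filter_upwards [eventually_ge_atTop (T.sup MvPolynomial.totalDegree)] with d hd
  apply le_antisymm
  · rw [Ideal.span_le]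
    rintro _ ⟨c, hc, rfl⟩
    exact hμ.mem_momentKernel_iff.1 hc
  · conv_lhs => rw [← hT]
    refine Submodule.span_mono fun P hP => ?_
    have hPd : P ∈ MvPolynomial.restrictTotalDegree (Fin p) ℝ d :=
      (MvPolynomial.mem_restrictTotalDegree _ _ _).2 ((Finset.le_sup hP).trans hd)
    rw [← range_polyOfCoeffsLinear] at hPd
    obtain ⟨c, rfl⟩ := hPd
    refine ⟨c, hμ.mem_momentKernel_iff.2 ?_, rfl⟩
    rw [← hT]
    exact Submodule.subset_span hP

theorem span_range_polyOfCoeffs_basis {d : ℕ} {K : Submodule ℝ (Exponent p d → ℝ)} {ι : Type*}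
    (b : Module.Basis ι ℝ K) :
    Ideal.span (Set.range fun i => polyOfCoeffs (b i).1) =
      Ideal.span (polyOfCoeffs '' (K : Set (Exponent p d → ℝ))) := by
  apply le_antisymm
  · refine Ideal.span_mono ?_
    rintro _ ⟨i, rfl⟩
    exact ⟨_, (b i).2, rfl⟩
  · rw [Ideal.span_le]
    rintro _ ⟨c, hc, rfl⟩
    set J := Ideal.span (Set.range fun i => polyOfCoeffs (b i).1)
    -- The coefficient vectors whose polynomial lies in `J` form a subspace containing the basis.
    have htop : (⊤ : Submodule ℝ K) ≤
        (J.restrictScalars ℝ).comap ((polyOfCoeffsLinear p d).comp K.subtype) := by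
      rw [← b.span_eq, Submodule.span_le]
      rintro _ ⟨i, rfl⟩
      exact Ideal.subset_span ⟨i, rfl⟩
    exact htop (Submodule.mem_top (x := (⟨c, hc⟩ : K)))

end MomentMatrix

end MomentRank

theorem mainTheorem5 (p : ℕ) (μ : MeasureTheory.Measure (Fin p → ℝ))
    [MeasureTheory.IsProbabilityMeasure μ] (hμ : MomentRank.HasFiniteMoments μ)
    (V : Set (Fin p → ℝ)) (hV : V = MomentRank.zariskiClosure μ.support)
    (I : Ideal (MvPolynomial (Fin p) ℝ)) (hI : I = MvPolynomial.vanishingIdeal ℝ V) :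
    (I : Set (MvPolynomial (Fin p) ℝ)) = {P | ∫ x, MvPolynomial.eval x P ^ 2 ∂μ = 0} ∧
    (∀ d : ℕ,
      (MomentRank.momentMatrix μ d).rank = MomentRank.hilbertFunction I d ∧
      MomentRank.hilbertFunction I d =
        Module.finrank ℝ (MomentRank.polynomialFunctions V d)) ∧
    (∃ H : Polynomial ℚ, (H.natDegree : WithBot ℕ∞) = MomentRank.algebraicDim V ∧
      ∃ d₀ : ℕ, ∀ d ≥ d₀, ((MomentRank.momentMatrix μ d).rank : ℚ) = H.eval (d : ℚ)) ∧
    (∃ d₀ : ℕ, ∀ d ≥ d₀,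
      Ideal.span (MomentRank.polyOfCoeffs '' (MomentRank.momentKernel μ d :
          Set (MomentRank.Exponent p d → ℝ))) = I ∧
      ∀ (ι : Type) (b : Module.Basis ι ℝ (MomentRank.momentKernel μ d)),
        Ideal.span (Set.range fun i => MomentRank.polyOfCoeffs (b i).1) = I) := by
  subst hV hI
  refine ⟨?_, fun d => ⟨?_, MomentRank.hilbertFunction_vanishingIdeal _ d⟩, ?_, ?_⟩
  · ext P
    exact hμ.integral_eval_sq_eq_zero_iff.symm
  · rw [hμ.rank_momentMatrix, MomentRank.hilbertFunction_eq_finrank_degreeFiltration]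
  · have hne := MomentRank.vanishingIdeal_zariskiClosure_ne_top
      (MeasureTheory.Measure.nonempty_support (MeasureTheory.IsProbabilityMeasure.ne_zero μ))
    obtain ⟨H, hdeg, hH⟩ := MomentRank.exists_hilbertPolynomial_natDegree_eq hne
    obtain ⟨d₀, hd₀⟩ := eventually_atTop.1 hH
    exact ⟨H, hdeg, d₀, fun d hd => by rw [hμ.rank_momentMatrix, hd₀ d hd]⟩
  · obtain ⟨d₀, hd₀⟩ := eventually_atTop.1 hμ.eventually_span_momentKernel
    exact ⟨d₀, fun d hd => ⟨hd₀ d hd, fun ι b =>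
      (MomentRank.span_range_polyOfCoeffs_basis b).trans (hd₀ d hd)⟩⟩
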